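/- There are functions $k, d : \mathbb{N} \to \mathbb{N}$ with $k(n) = n^{3+o(1)}$ and $d(n) = n^{3+o(1)}$ such that no (computationally unbounded, possibly randomized and stateful) oracle $\mathcal{O}$ is, for every $n \in \mathbb{N}$, $(1/2000, o_n(1))$-accurate for $k(n)$ adaptively chosen queries given $n$ samples in $\{0,1\}^{d(n)}$. In other words, there are no oracles $\mathcal{O}_n$ ($n \in \mathbb{N}$) and numbers $\beta(n) \to 0$ such that for every $n$ the oracle $\mathcal{O}_n$ is $(1/2000, \beta(n))$-accurate for $k(n)$ adaptively chosen queries given $n$ samples in $\{0,1\}^{d(n)}$. Here a statistical query on $\{0,1\}^d$ is a predicate $q : \{0,1\}^d \to \{0,1\}$, and its value on a distribution $\mathcal{D}$ over $\{0,1\}^d$ is $q(\mathcal{D}) = \mathbb{E}_{x \sim \mathcal{D}}[q(x)]$. An oracle $\mathcal{O}$ is $(\alpha,\beta)$-accurate for $k$ adaptively chosen queries given $n$ samples in $\{0,1\}^d$ if, for every (computationally unbounded, possibly randomized and stateful) adversary $\mathcal{A}$, with probability at least $1-\beta$ one has $|a_j - q_j(\mathcal{D})| \le \alpha$ for all $j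 = 1, \dots, k$ in the following game: $\mathcal{A}$ chooses a distribution $\mathcal{D}$ over $\{0,1\}^d$; $\mathcal{O}$ receives i.i.d. samples $x_1, \dots, x_n$ from $\mathcal{D}$, which $\mathcal{A}$ does not see; for $j = 1, \dots, k$, $\mathcal{A}$ chooses a query $q_j$ depending on $q_1, a_1, \dots, q_{j-1}, a_{j-1}$ (and on its own state and randomness), and $\mathcal{O}$ returns an answer $a_j \in [0,1]$. -/

import Mathlib

open Filter Topology MeasureTheory

/-- The data universe `{0,1}^d`. -/
abbrev DataPoint (d : ℕ) : Type := Fin d → Bool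

/-- A statistical query on `{0,1}^d`: a predicate `{0,1}^d → {0,1}`. -/
abbrev StatQuery (d : ℕ) : Type := DataPoint d → Bool

/-- The value `q(D) = E_{x ← D}[q(x)]` of a statistical query on a distribution over `{0,1}^d`. -/
noncomputable def StatQuery.value {d : ℕ} (q : StatQuery d) (D : PMF (DataPoint d)) : ℝ :=
  ∑ x : DataPoint d, (D x).toReal * (if q x = true then 1 else 0)

/-- A (computationally unbounded, randomized, stateful) oracle that holds `n` samples in `{0,1}^d`
and answers statistical queries by numbers in `[0,1]`. All its randomness is a random tape drawn
from an arbitrary probability space. Given the tape, the answer to the current query `q` may depend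
on the samples and on everything that happened before (its state), that is on the earlier queries
`h`; its own earlier answers are determined by the same data. -/
structure StatOracle (n d : ℕ) where
  Coins : Type*
  [measurableSpace : MeasurableSpace Coins]
  law : Measure Coins
  [isProbabilityMeasure : IsProbabilityMeasure law]
  /-- the answer to query number `j` (counted from `0`) -/
  answer : (j : ℕ) → Coins → (x : Fin n → DataPoint d) → (h : Fin j → StatQuery d) →
    (q : StatQuery d) → unitInterval
  measurable_answer : ∀ j x h q, Measurable fun ω => answer j ω x h q

attribute [instance] StatOracle.measurableSpace StatOracle.isProbabilityMeasure

/-- A (computationally unbounded, randomized, stateful) adversary: it chooses a distribution over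
`{0,1}^d`, and then, for each `j`, a query as a function of its random tape and the transcript
`(q₁, a₁), …, (q_j, a_j)` of the earlier queries and answers. -/
structure Adversary (d : ℕ) where
  Coins : Type
  [measurableSpace : MeasurableSpace Coins]
  law : Measure Coins
  [isProbabilityMeasure : IsProbabilityMeasure law]
  dist : Coins → PMF (DataPoint d)
  measurable_dist : ∀ x, Measurable fun ω => dist ω x
  query : (j : ℕ) → Coins → (Fin j → StatQuery d × unitInterval) → StatQuery d
  measurable_query : ∀ j,
    Measurable fun p : Coins × (Fin j → StatQuery d × unitInterval) => query j p.1 p.2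

attribute [instance] Adversary.measurableSpace Adversary.isProbabilityMeasure

/-- The first `j` queries and answers of the interaction between oracle and adversary, for a given
tape `ωA` of the adversary, samples `x` and tape `ωO` of the oracle. -/
def transcript {n d : ℕ} (O : StatOracle n d) (A : Adversary d) (ωA : A.Coins)
    (x : Fin n → DataPoint d) (ωO : O.Coins) : (j : ℕ) → Fin j → StatQuery d × unitInterval
  | 0 => Fin.elim0
  | j + 1 =>
    let t := transcript O A ωA x ωO j
    let q := A.query j ωA t
    Fin.snoc (α := fun _ => StatQuery d × unitInterval) t
      (q, O.answer j ωO x (fun i => (t i).1) q)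

/-- The probability that in the accuracy game with `k` queries all answers are within `α` of the
true values: the adversary draws its tape and thereby a distribution `D`, the `n` samples are drawn
i.i.d. from `D`, and the oracle draws its tape independently. -/
noncomputable def accuracyProb {n d : ℕ} (O : StatOracle n d) (A : Adversary d) (k : ℕ) (α : ℝ) :
    ENNReal :=
  ∫⁻ ωA, ((Measure.pi fun _ : Fin n => (A.dist ωA).toMeasure).prod O.law)
    {p | ∀ j : Fin k,
      |((transcript O A ωA p.1 p.2 k j).2 : ℝ)
        - (transcript O A ωA p.1 p.2 k j).1.value (A.dist ωA)| ≤ α} ∂A.law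

/-- The oracle is `(α, β)`-accurate for `k` adaptively chosen queries given `n` samples in
`{0,1}^d`. -/
def StatOracle.IsAccurate {n d : ℕ} (O : StatOracle n d) (α β : ℝ) (k : ℕ) : Prop :=
  ∀ A : Adversary d, 1 - β ≤ (accuracyProb O A k α).toReal

/-- `f(n) = n^{c + o(1)}` as `n → ∞`. -/
def IsPowPlusLittleO (f : ℕ → ℕ) (c : ℝ) : Prop :=
  ∃ ε : ℕ → ℝ, Tendsto ε atTop (𝓝 0) ∧ ∀ᶠ n in atTop, (f n : ℝ) = (n : ℝ) ^ (c + ε n)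

/-! This is an interactive fingerprinting attack. Each of `N = n^2` users has a data point made of a
random key and its name, and `D` is uniform on these points. In every round the adversary draws a
bias `p` and a `p`-biased bit for each user, encrypts each bit with a fresh bit of that user's key,
and asks for the mean of the bits. The score of a user adds up `a * (bit - p)` over the answers `a`.
A user whose score exceeds `σ` is accused: the score freezes and the user counts as zero from then
on.

The sum of `E[a * (2p - 1)]` over the `k` rounds is bounded from both sides. Accuracy keeps `a`
close to `p`, so a round contributes nearly `E[p * (2p - 1)] = 1/6`, as long as few users are
accused. Users in the sample are a small fraction; the others have scores with second moment at most
`k`, so Chebyshev's inequality applies (`Attack.rounds_le`). Conversely, `expect_fingerprint`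
rewrites `E[a * (2p - 1)]` as the correlation of `a` with the sum of all deviations `bit - p`. Users
outside the sample contribute nothing, because the oracle lacks their keys, and each sampled user
contributes at most `σ + 1` over the whole game (`Attack.sum_expect_le`). Hence `k` is at most of
order `n * σ`, which fails for `k = n^3` and `σ = n^2 / 100`.

Fixing the oracle's tape and the identities of the sampled users (`exists_accurate`), and replacing
the uniform law of `p` by a quadrature rule, turns all these expectations into finite sums. -/

/-! ### Quadrature and the law of the biases -/

/-- In a finite-dimensional space the convex hull of a compact set is compact. -/
theorem IsCompact.isCompact_convexHull_of_finiteDimensional {E : Type*} [NormedAddCommGroup E]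
    [NormedSpace ℝ E] [FiniteDimensional ℝ E] {s : Set E} (hs : IsCompact s) :
    IsCompact (convexHull ℝ s) := by
  rcases s.eq_empty_or_nonempty with rfl | ⟨s₀, hs₀⟩
  · simp
  set m := Module.finrank ℝ E + 1
  have himage : convexHull ℝ s = (fun p : (Fin m → ℝ) × (Fin m → E) => ∑ i, p.1 i • p.2 i) ''
      (stdSimplex ℝ (Fin m) ×ˢ Set.univ.pi fun _ => s) := by
    apply Set.Subset.antisymm
    · intro x hx
      obtain ⟨ι, _, z, w, hz, hind, hw, hw1, hx⟩ := eq_pos_convex_span_of_mem_convexHull hx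
      have hcard : Fintype.card ι ≤ Fintype.card (Fin m) := by
        simpa [m] using hind.card_le_finrank_succ.trans
          (Nat.succ_le_succ (Submodule.finrank_le (vectorSpan ℝ (Set.range z))))
      obtain ⟨e⟩ := Function.Embedding.nonempty_of_card_le hcard
      have hout (i : Fin m) (hi : i ∉ Set.range e) : Function.extend e w 0 i = 0 :=
        Function.extend_apply' _ _ _ hi
      -- By Carathéodory at most `m` points are needed; spare slots get weight `0` and the dummy
      -- point `s₀`, which keeps the tuple in `s`.
      refine ⟨(Function.extend e w 0, Function.extend e z fun _ => s₀), ⟨⟨fun i => ?_, ?_⟩, ?_⟩, ?_⟩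
      · by_cases hi : i ∈ Set.range e
        · obtain ⟨i, rfl⟩ := hi
          simpa [e.injective.extend_apply] using (hw i).le
        · exact (hout i hi).ge
      · rw [← Fintype.sum_of_injective e e.injective _ _ hout fun _ => rfl]
        simpa [e.injective.extend_apply] using hw1
      · intro i _
        by_cases hi : i ∈ Set.range e
        · obtain ⟨i, rfl⟩ := hi
          simpa [e.injective.extend_apply] using hz ⟨i, rfl⟩
        · simpa [Function.extend_apply' _ _ _ hi] using hs₀
      · simp only
        rw [← Fintype.sum_of_injective e e.injective _ _
          (fun i hi => by rw [hout i hi, zero_smul]) fun _ => rfl]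
        simpa [e.injective.extend_apply] using hx
    · rintro _ ⟨⟨w, z⟩, ⟨hw, hz⟩, rfl⟩
      exact mem_convexHull_of_exists_fintype w z hw.1 hw.2 (fun i => hz i trivial) rfl
  rw [himage]
  exact ((isCompact_stdSimplex ℝ _).prod (isCompact_univ_pi fun _ => hs)).image (by fun_prop)

/-- There is a quadrature rule on `[0,1]` with nonnegative weights that is exact for polynomials
of degree at most `L`. -/
theorem exists_quadrature (L : ℕ) :
    ∃ (ι : Type) (_ : Fintype ι) (w pt : ι → ℝ), (∀ l, 0 ≤ w l) ∧ ∑ l, w l = 1 ∧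
      (∀ l, pt l ∈ Set.Icc (0 : ℝ) 1) ∧ ∀ Q : Polynomial ℝ, Q.natDegree ≤ L →
        ∑ l, w l * Q.eval (pt l) = ∫ x in (0 : ℝ)..1, Q.eval x := by
  let μ : Measure ℝ := volume.restrict (Set.Icc 0 1)
  have : IsProbabilityMeasure μ := ⟨by simp [μ]⟩
  let f : ℝ → Fin (L + 1) → ℝ := fun x e => x ^ (e : ℕ)
  have hf : Continuous f := by fun_prop
  have hint (e : Fin (L + 1)) : Integrable (fun x => f x e) μ :=
    (Continuous.continuousOn (by fun_prop)).integrableOn_compact isCompact_Icc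
  -- The mean of a law on the moment curve lies in the closed convex hull, and by compactness the
  -- hull is already closed.
  have hmem : ∫ x, f x ∂μ ∈ convexHull ℝ (f '' Set.Icc 0 1) := by
    refine (convex_convexHull ℝ _).integral_mem
      (isCompact_Icc.image hf).isCompact_convexHull_of_finiteDimensional.isClosed ?_
      (Integrable.of_eval hint)
    filter_upwards [ae_restrict_mem measurableSet_Icc] with x hx
    exact subset_convexHull ℝ _ ⟨x, hx, rfl⟩
  obtain ⟨ι, hι, w, z, hw, hw1, hz, hsum⟩ := mem_convexHull_iff_exists_fintype.1 hmem
  choose pt hpt hzpt using hz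
  refine ⟨ι, hι, w, pt, hw, hw1, hpt, fun Q hQ => ?_⟩
  have hmoment (e : ℕ) (he : e < L + 1) : ∑ l, w l * pt l ^ e = ∫ x in (0 : ℝ)..1, x ^ e := by
    have h := congrFun hsum ⟨e, he⟩
    rw [eval_integral hint] at h
    rw [intervalIntegral.integral_of_le zero_le_one, ← integral_Icc_eq_integral_Ioc]
    simpa [← hzpt, f, μ] using h
  simp_rw [Polynomial.eval_eq_sum_range' (Nat.lt_succ_of_le hQ), Finset.mul_sum]
  rw [Finset.sum_comm, intervalIntegral.integral_finsetSum
    fun i _ => Continuous.intervalIntegrable (by fun_prop) _ _]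
  refine Finset.sum_congr rfl fun e he => ?_
  rw [intervalIntegral.integral_const_mul, ← hmoment e (by simpa using he), Finset.mul_sum]
  exact Finset.sum_congr rfl fun l _ => by ring

/-- A finitely supported law on `[0,1]` for the biases of codewords of length `N`. The last two
fields are identities that hold for the uniform law on `[0,1]`. -/
structure FingerprintLaw (N : ℕ) where
  Node : Type
  [fintype : Fintype Node]
  [decidableEq : DecidableEq Node]
  w : Node → ℝ
  pt : Node → ℝ
  w_nonneg : ∀ l, 0 ≤ w l
  sum_w : ∑ l, w l = 1
  pt_nonneg : ∀ l, 0 ≤ pt l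
  pt_le_one : ∀ l, pt l ≤ 1
  correlation : ∑ l, w l * ((2 * pt l - 1) * pt l) = 1 / 6
  fingerprint : ∀ a b, a + b = N →
    ∑ l, w l * (pt l ^ a * (1 - pt l) ^ b * (a - N * pt l + (1 - 2 * pt l))) = 0

attribute [instance] FingerprintLaw.fintype FingerprintLaw.decidableEq

open Polynomial in
-- For the uniform law the `fingerprint` sum is the integral of the derivative of `p ^ (a + 1) * (1
-- - p) ^ (b + 1)`, which vanishes at both ends. Both required identities concern polynomials of
-- degree at most `N + 2`, so quadrature preserves them.
theorem FingerprintLaw.nonempty (N : ℕ) : Nonempty (FingerprintLaw N) := by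
  classical
  obtain ⟨ι, _, w, pt, hw, hw1, hpt, hquad⟩ := exists_quadrature (N + 2)
  refine ⟨⟨ι, w, pt, hw, hw1, fun l => (hpt l).1, fun l => (hpt l).2, ?_, fun a b hab => ?_⟩⟩
  · have h := hquad ((C 2 * X - 1) * X) (by
      refine natDegree_mul_le.trans ((Nat.add_le_add (natDegree_sub_le _ _)
        natDegree_X.le).trans ?_)
      have : (C (2 : ℝ) * X).natDegree ≤ 1 := natDegree_C_mul_le _ _ |>.trans natDegree_X_le
      simp only [natDegree_one]
      omega)
    simp only [eval_mul, eval_sub, eval_C, eval_X, eval_one] at h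
    rw [h]
    have : ∀ x : ℝ, (2 * x - 1) * x = 2 * x ^ 2 - x := fun x => by ring
    simp_rw [this]
    rw [intervalIntegral.integral_sub (Continuous.intervalIntegrable (by fun_prop) _ _)
      (Continuous.intervalIntegrable (by fun_prop) _ _), intervalIntegral.integral_const_mul]
    norm_num
  · set H : ℝ[X] := X ^ (a + 1) * (1 - X) ^ (b + 1)
    have hdeg : H.derivative.natDegree ≤ N + 2 := by
      refine (natDegree_derivative_le H).trans ((Nat.sub_le _ _).trans ?_)
      have h1 : (1 - X : ℝ[X]).natDegree ≤ 1 := (natDegree_sub_le _ _).trans (by simp)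
      refine natDegree_mul_le.trans ?_
      have h2 := natDegree_pow_le (p := (1 - X : ℝ[X])) (n := b + 1)
      have h3 := Nat.mul_le_mul_left (b + 1) h1
      rw [natDegree_X_pow]
      omega
    have h := hquad _ hdeg
    rw [intervalIntegral.integral_eq_sub_of_hasDerivAt (fun x _ => H.hasDerivAt x)
      (Continuous.intervalIntegrable (by fun_prop) _ _)] at h
    have hend : H.eval 1 - H.eval 0 = 0 := by simp [H]
    rw [← hend, ← h]
    refine Finset.sum_congr rfl fun l _ => ?_
    have hN : (N : ℝ) = a + b := by exact_mod_cast hab.symm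
    have hder : H.derivative = (C ((a : ℝ) + 1) * X ^ a) * (1 - X) ^ (b + 1)
        - X ^ (a + 1) * (C ((b : ℝ) + 1) * (1 - X) ^ b) := by
      simp only [H, derivative_mul, derivative_pow, derivative_sub, derivative_one, derivative_X]
      push_cast
      ring
    simp only [hder, eval_mul, eval_sub, eval_pow, eval_C, eval_X, eval_one]
    rw [hN]
    ring

/-! ### Expectations over tapes and the cancellation identities -/

namespace FingerprintLaw

variable {N k : ℕ} (Λ : FingerprintLaw N)

/-- The randomness of one round: a bias, one codeword bit per user and one key bit per user. -/
abbrev Round : Type := Λ.Node × (Fin N → Bool) × (Fin N → Bool)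

/-- The probability of `b` under the Bernoulli law with mean `p`. -/
noncomputable def bern (p : ℝ) (b : Bool) : ℝ := if b then p else 1 - p

noncomputable def roundWeight (ρ : Λ.Round) : ℝ :=
  Λ.w ρ.1 * (∏ i, bern (Λ.pt ρ.1) (ρ.2.1 i)) * (1 / 2) ^ N

/-- The deviation of the codeword bit of user `i` from its mean. -/
noncomputable def dev (ρ : Λ.Round) (i : Fin N) : ℝ := (if ρ.2.1 i then 1 else 0) - Λ.pt ρ.1

noncomputable def tapeWeight (ω : Fin k → Λ.Round) : ℝ := ∏ j, Λ.roundWeight (ω j)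

/-- The expectation over `k` independent rounds. -/
noncomputable def expect (F : (Fin k → Λ.Round) → ℝ) : ℝ := ∑ ω, Λ.tapeWeight ω * F ω

theorem abs_dev_le_one (ρ : Λ.Round) (i : Fin N) : |Λ.dev ρ i| ≤ 1 := by
  have h0 := Λ.pt_nonneg ρ.1
  have h1 := Λ.pt_le_one ρ.1
  unfold dev
  split_ifs <;> rw [abs_le] <;> constructor <;> linarith

theorem roundWeight_nonneg (ρ : Λ.Round) : 0 ≤ Λ.roundWeight ρ := by
  refine mul_nonneg (mul_nonneg (Λ.w_nonneg _) (Finset.prod_nonneg fun i _ => ?_)) (by positivity)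
  have h0 := Λ.pt_nonneg ρ.1
  have h1 := Λ.pt_le_one ρ.1
  unfold bern
  split_ifs <;> linarith

theorem tapeWeight_nonneg (ω : Fin k → Λ.Round) : 0 ≤ Λ.tapeWeight ω :=
  Finset.prod_nonneg fun _ _ => Λ.roundWeight_nonneg _

theorem sum_prod_bern (p : ℝ) : ∑ c : Fin N → Bool, ∏ i, bern p (c i) = 1 := by
  rw [← Fintype.sum_pow (bern p) N]
  simp [bern]

theorem sum_roundWeight_mul (g : Λ.Node → ℝ) :
    ∑ ρ : Λ.Round, Λ.roundWeight ρ * g ρ.1 = ∑ l, Λ.w l * g l := by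
  simp only [roundWeight, Fintype.sum_prod_type, Finset.sum_const, Finset.card_univ]
  refine Finset.sum_congr rfl fun l _ => ?_
  simp only [nsmul_eq_mul, Fintype.card_pi, Fintype.card_bool, Finset.prod_const, Finset.card_univ,
    Fintype.card_fin]
  have h (c : Fin N → Bool) : ((2 ^ N : ℕ) : ℝ) * (Λ.w l * (∏ i, bern (Λ.pt l) (c i)) *
      (1 / 2) ^ N * g l) = Λ.w l * g l * ∏ i, bern (Λ.pt l) (c i) := by
    have : (2 : ℝ) ^ N * (1 / 2) ^ N = 1 := by rw [← mul_pow]; norm_num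
    push_cast
    linear_combination (Λ.w l * (∏ i, bern (Λ.pt l) (c i)) * g l) * this
  simp_rw [h]
  rw [← Finset.mul_sum, sum_prod_bern, mul_one]

theorem sum_roundWeight : ∑ ρ : Λ.Round, Λ.roundWeight ρ = 1 := by
  simpa [Λ.sum_w] using Λ.sum_roundWeight_mul fun _ => 1

theorem expect_comp_node (j : Fin k) (g : Λ.Node → ℝ) :
    Λ.expect (fun ω => g (ω j).1) = ∑ l, Λ.w l * g l := by
  classical
  have h (ω : Fin k → Λ.Round) : Λ.tapeWeight ω * g (ω j).1 =
      ∏ j', Λ.roundWeight (ω j') * (if j' = j then g (ω j').1 else 1) := by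
    rw [Finset.prod_mul_distrib, Finset.prod_ite_eq' Finset.univ j fun j' => g (ω j').1]
    simp [tapeWeight]
  have hsum := Finset.prod_univ_sum (fun _ : Fin k => (Finset.univ : Finset Λ.Round))
    fun j' ρ => Λ.roundWeight ρ * (if j' = j then g ρ.1 else 1)
  rw [Fintype.piFinset_univ] at hsum
  simp only [expect, h]
  rw [← hsum, ← Λ.sum_roundWeight_mul g, Finset.prod_eq_single j]
  · simp
  · intro j' _ hj'
    simp [hj', Λ.sum_roundWeight]
  · simp

theorem sum_tapeWeight : ∑ ω : Fin k → Λ.Round, Λ.tapeWeight ω = 1 := by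
  have h := Fintype.piFinset_univ (α := Fin k) (β := fun _ => Λ.Round)
  simp only [tapeWeight]
  rw [← h, ← Finset.prod_univ_sum (fun _ : Fin k => (Finset.univ : Finset Λ.Round))
    fun _ ρ => Λ.roundWeight ρ]
  simp [Λ.sum_roundWeight]

section Linearity

variable {Λ} (F G : (Fin k → Λ.Round) → ℝ)

theorem expect_add : Λ.expect (fun ω => F ω + G ω) = Λ.expect F + Λ.expect G := by
  simp [expect, mul_add, Finset.sum_add_distrib]

theorem expect_sub : Λ.expect (fun ω => F ω - G ω) = Λ.expect F - Λ.expect G := by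
  simp [expect, mul_sub, Finset.sum_sub_distrib]

theorem expect_const_mul (r : ℝ) : Λ.expect (fun ω => r * F ω) = r * Λ.expect F := by
  simp [expect, Finset.mul_sum, mul_left_comm]

theorem expect_const (r : ℝ) : Λ.expect (fun _ : Fin k → Λ.Round => r) = r := by
  simp [expect, ← Finset.sum_mul, Λ.sum_tapeWeight]

theorem expect_sum {κ : Type*} (s : Finset κ) (F : κ → (Fin k → Λ.Round) → ℝ) :
    Λ.expect (fun ω => ∑ i ∈ s, F i ω) = ∑ i ∈ s, Λ.expect (F i) := by
  simp only [expect, Finset.mul_sum]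
  exact Finset.sum_comm

variable {F G} in
theorem expect_mono (h : ∀ ω, F ω ≤ G ω) : Λ.expect F ≤ Λ.expect G :=
  Finset.sum_le_sum fun ω _ => mul_le_mul_of_nonneg_left (h ω) (Λ.tapeWeight_nonneg ω)

end Linearity

variable {Λ}

theorem tapeWeight_update (ω : Fin k → Λ.Round) (j : Fin k) (ρ : Λ.Round) :
    Λ.tapeWeight (Function.update ω j ρ) =
      (∏ j' ∈ Finset.univ \ {j}, Λ.roundWeight (ω j')) * Λ.roundWeight ρ := by
  rw [tapeWeight, ← Finset.prod_sdiff (Finset.subset_univ {j}), Finset.prod_singleton,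
    Function.update_self]
  congr 1
  refine Finset.prod_congr rfl fun j' hj' => ?_
  rw [Function.update_of_ne (by simpa using hj')]

/-- Flip the codeword bit of user `i`, and its key bit too if `b` is true. -/
def flip (b : Bool) (i : Fin N) (ρ : Λ.Round) : Λ.Round :=
  (ρ.1, Function.update ρ.2.1 i (!ρ.2.1 i),
    if b then Function.update ρ.2.2 i (!ρ.2.2 i) else ρ.2.2)

theorem flip_flip (b : Bool) (i : Fin N) (ρ : Λ.Round) : flip b i (flip b i ρ) = ρ := by
  rcases ρ with ⟨l, c, r⟩
  cases b <;> simp [flip]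

/-- In the bit of user `i`, weight times deviation is `p * (1 - p)` or its negative; key bits are
uniform, so flipping one costs nothing. -/
theorem roundWeight_flip_mul_dev (b : Bool) (i : Fin N) (ρ : Λ.Round) :
    Λ.roundWeight (flip b i ρ) * Λ.dev (flip b i ρ) i = -(Λ.roundWeight ρ * Λ.dev ρ i) := by
  have hprod (c : Fin N → Bool) (x : Bool) : ∏ i', bern (Λ.pt ρ.1) (Function.update c i x i') =
      (∏ i' ∈ Finset.univ \ {i}, bern (Λ.pt ρ.1) (c i')) * bern (Λ.pt ρ.1) x := by
    rw [← Finset.prod_sdiff (Finset.subset_univ {i}), Finset.prod_singleton, Function.update_self]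
    congr 1
    refine Finset.prod_congr rfl fun j' hj' => ?_
    rw [Function.update_of_ne (by simpa using hj')]
  have hself := hprod ρ.2.1 (ρ.2.1 i)
  rw [Function.update_eq_self] at hself
  simp only [roundWeight, dev, flip, Function.update_self, hprod, hself]
  cases ρ.2.1 i <;> simp [bern] <;> ring

/-- The flip is an involution that changes the sign of every weighted deviation. With `b` true it
preserves the ciphertext, which gives the secrecy of the one-time pad; with `b` false it preserves
all keys, which suits bits that the query ignores. -/
theorem expect_mul_dev_eq_zero (b : Bool) (i : Fin N) (j : Fin k) (F : (Fin k → Λ.Round) → ℝ)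
    (hF : ∀ ω, F (Function.update ω j (flip b i (ω j))) = F ω) :
    Λ.expect (fun ω => F ω * Λ.dev (ω j) i) = 0 := by
  have hinv : Function.Involutive fun ω : Fin k → Λ.Round =>
      Function.update ω j (flip b i (ω j)) := fun ω => by simp [flip_flip]
  have h : Λ.expect (fun ω => F ω * Λ.dev (ω j) i) = -Λ.expect (fun ω => F ω * Λ.dev (ω j) i) := by
    unfold expect
    rw [← Finset.sum_neg_distrib]
    conv_lhs => rw [← Equiv.sum_comp hinv.toPerm]
    refine Finset.sum_congr rfl fun ω _ => ?_
    have hω := tapeWeight_update ω j (ω j)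
    rw [Function.update_eq_self] at hω
    simp only [Function.Involutive.coe_toPerm, hF, Function.update_self]
    rw [tapeWeight_update, hω]
    linear_combination (∏ j' ∈ Finset.univ \ {j}, Λ.roundWeight (ω j')) * F ω *
      roundWeight_flip_mul_dev b i (ω j)
  linarith

theorem sum_roundWeight_fingerprint (c r : Fin N → Bool) :
    ∑ l, Λ.roundWeight (l, c, r) * (∑ i, Λ.dev (l, c, r) i + (1 - 2 * Λ.pt l)) = 0 := by
  set a := (Finset.univ.filter fun i => c i = true).card
  set b := (Finset.univ.filter fun i => ¬ c i = true).card
  have hab : a + b = N := by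
    rw [Finset.card_filter_add_card_filter_not (s := (Finset.univ : Finset (Fin N)))
      (fun i => c i = true), Finset.card_univ, Fintype.card_fin]
  have hsum (l : Λ.Node) : ∑ i, Λ.dev (l, c, r) i = a - N * Λ.pt l := by
    simp [dev, Finset.sum_sub_distrib, a]
  have hprod (l : Λ.Node) : ∏ i, bern (Λ.pt l) (c i) = Λ.pt l ^ a * (1 - Λ.pt l) ^ b := by
    simp [bern, Finset.prod_ite, a, b]
  have h := Λ.fingerprint a b hab
  simp only [roundWeight, hsum, hprod]
  rw [← mul_zero ((1 / 2 : ℝ) ^ N), ← h, Finset.mul_sum]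
  exact Finset.sum_congr rfl fun l _ => by ring

/-- The fingerprinting identity: if `F` does not depend on the bias of round `j`, then it
correlates with the sum of the codeword deviations as it does with `2 * p - 1`. -/
theorem expect_fingerprint (j : Fin k) (F : (Fin k → Λ.Round) → ℝ)
    (hF : ∀ ω l, F (Function.update ω j (l, (ω j).2)) = F ω) :
    Λ.expect (fun ω => F ω * ∑ i, Λ.dev (ω j) i) =
      Λ.expect (fun ω => F ω * (2 * Λ.pt (ω j).1 - 1)) := by
  have hne : Nonempty Λ.Node := by
    by_contra h
    have := Λ.sum_w
    simp [not_nonempty_iff.1 h] at this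
  set G : (Fin k → Λ.Round) → ℝ := fun ω => Λ.tapeWeight ω *
    (F ω * (∑ i, Λ.dev (ω j) i + (1 - 2 * Λ.pt (ω j).1)))
  have hzero (ω : Fin k → Λ.Round) : ∑ l, G (Function.update ω j (l, (ω j).2)) = 0 := by
    have h := sum_roundWeight_fingerprint (Λ := Λ) (ω j).2.1 (ω j).2.2
    simp only [G, hF, Function.update_self, tapeWeight_update]
    rw [← mul_zero ((∏ j' ∈ Finset.univ \ {j}, Λ.roundWeight (ω j')) * F ω), ← h, Finset.mul_sum]
    exact Finset.sum_congr rfl fun l _ => by ring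
  -- Exchanging the bias of round `j` with a spare node turns the sum over tapes, repeated once per
  -- node, into sums over all biases of round `j`, each of them zero.
  have hinv : Function.Involutive fun q : (Fin k → Λ.Round) × Λ.Node =>
      (Function.update q.1 j (q.2, (q.1 j).2), (q.1 j).1) := fun q => by simp
  have hsum : ∑ q : (Fin k → Λ.Round) × Λ.Node, G q.1 = 0 := by
    rw [← Equiv.sum_comp hinv.toPerm, Fintype.sum_prod_type]
    exact Finset.sum_eq_zero fun ω _ => hzero ω
  have hG : ∑ ω, G ω = 0 := by
    rw [Fintype.sum_prod_type, Finset.sum_congr rfl fun ω _ => Finset.sum_const _,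
      ← Finset.smul_sum, smul_eq_zero] at hsum
    simpa using hsum
  rw [← sub_eq_zero, ← expect_sub, ← hG]
  exact Finset.sum_congr rfl fun ω _ => by simp only [G]; ring

/-- The expected square of the sum of the codeword deviations. -/
theorem expect_sq_sum_dev_le {N k : ℕ} (Λ : FingerprintLaw N) (j : Fin k) :
    Λ.expect (fun ω => (∑ i, Λ.dev (ω j) i) ^ 2) ≤ N := by
  simp_rw [sq, Finset.sum_mul]
  rw [expect_sum]
  have h (i : Fin N) : Λ.expect (fun ω => Λ.dev (ω j) i * ∑ i', Λ.dev (ω j) i') ≤ 1 := by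
    -- The deviations of distinct users are uncorrelated, so only the diagonal terms remain.
    have hoff := expect_mul_dev_eq_zero true i j
      (fun ω : Fin k → Λ.Round => ∑ i' ∈ Finset.univ \ {i}, Λ.dev (ω j) i') fun ω => by
        refine Finset.sum_congr rfl fun i' hi' => ?_
        simp only [Function.update_self, dev, flip]
        rw [Function.update_of_ne (by simpa using hi')]
    rw [← expect_const (Λ := Λ) (k := k) 1, ← sub_nonpos, ← hoff, ← expect_sub]
    refine expect_mono fun ω => ?_
    rw [← Finset.sum_sdiff (Finset.subset_univ {i}), Finset.sum_singleton]
    have hd := sq_le_one_iff_abs_le_one _ |>.2 (Λ.abs_dev_le_one (ω j) i)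
    linarith
  simpa using Finset.sum_le_sum fun i (_ : i ∈ Finset.univ) => h i

/-! ### Two-sided bounds for an abstract attack -/

/-- The answers `a` and scores `Z` of an attack with `k` rounds against an oracle that holds the
data of the users in `S`, together with what they do not depend on. -/
structure Attack {N : ℕ} (Λ : FingerprintLaw N) (k : ℕ) (σ : ℝ) (S : Finset (Fin N)) where
  a : Fin k → (Fin k → Λ.Round) → ℝ
  Z : ℕ → Fin N → (Fin k → Λ.Round) → ℝ
  Z_zero : ∀ i ω, Z 0 i ω = 0
  Z_succ : ∀ (j : Fin k) i ω, Z (j + 1) i ω =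
    if Z j i ω ≤ σ then Z j i ω + a j ω * Λ.dev (ω j) i else Z j i ω
  a_nonneg : ∀ j ω, 0 ≤ a j ω
  a_le_one : ∀ j ω, a j ω ≤ 1
  a_update_node : ∀ (j : Fin k) ω l, a j (Function.update ω j (l, (ω j).2)) = a j ω
  a_flip_of_notMem : ∀ (j : Fin k) ω, ∀ i ∉ S,
    a j (Function.update ω j (flip true i (ω j))) = a j ω
  a_flip_of_lt : ∀ (j : Fin k) ω i, σ < Z j i ω →
    a j (Function.update ω j (flip false i (ω j))) = a j ω
  Z_flip_of_notMem : ∀ (j : Fin k) ω, ∀ i ∉ S,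
    Z j i (Function.update ω j (flip true i (ω j))) = Z j i ω
  Z_flip : ∀ (j : Fin k) ω i, Z j i (Function.update ω j (flip false i (ω j))) = Z j i ω

namespace Attack

variable {N k : ℕ} {Λ : FingerprintLaw N} {σ : ℝ} {S : Finset (Fin N)} (T : Attack Λ k σ S)

/-- Only scores up to `σ` still move, and each move is at most `1`. -/
theorem Z_le (hσ : 0 ≤ σ) (i : Fin N) (ω : Fin k → Λ.Round) {j : ℕ} (hj : j ≤ k) :
    T.Z j i ω ≤ σ + 1 := by
  induction j with
  | zero => rw [T.Z_zero]; linarith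
  | succ j ih =>
    rw [T.Z_succ ⟨j, hj⟩]
    have h := abs_le.1 (Λ.abs_dev_le_one (ω ⟨j, hj⟩) i)
    have h0 := T.a_nonneg ⟨j, hj⟩ ω
    have h1 := T.a_le_one ⟨j, hj⟩ ω
    split_ifs with hle
    · have : T.a ⟨j, hj⟩ ω * Λ.dev (ω ⟨j, hj⟩) i ≤ 1 := by nlinarith
      simp only at hle ⊢
      linarith
    · exact ih (Nat.le_of_succ_le hj)

theorem expect_a_mul_dev_of_notMem (j : Fin k) {i : Fin N} (hi : i ∉ S) :
    Λ.expect (fun ω => T.a j ω * Λ.dev (ω j) i) = 0 :=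
  expect_mul_dev_eq_zero true i j _ fun ω => T.a_flip_of_notMem j ω i hi

/-- The score of a user grows in expectation as if the user were never accused. -/
theorem expect_Z_succ_sub (j : Fin k) (i : Fin N) :
    Λ.expect (T.Z (j + 1) i) - Λ.expect (T.Z j i) =
      Λ.expect (fun ω => T.a j ω * Λ.dev (ω j) i) := by
  -- Once accused, the user is left out of the query and the answer ignores its bit, so the
  -- increments discarded by freezing have mean zero.
  have h := expect_mul_dev_eq_zero false i j (fun ω => if T.Z j i ω ≤ σ then 0 else T.a j ω)
    fun ω => by
      simp only [T.Z_flip]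
      split_ifs with h
      · rfl
      · exact T.a_flip_of_lt j ω i (not_le.1 h)
  rw [← expect_sub, ← add_zero (Λ.expect _), ← h, ← expect_add]
  congr 1
  funext ω
  rw [T.Z_succ]
  split_ifs <;> ring

theorem sum_expect_a_mul_dev (i : Fin N) :
    ∑ j, Λ.expect (fun ω => T.a j ω * Λ.dev (ω j) i) = Λ.expect (T.Z k i) := by
  simp_rw [← T.expect_Z_succ_sub]
  rw [Fin.sum_univ_eq_sum_range (fun j => Λ.expect (T.Z (j + 1) i) - Λ.expect (T.Z j i)),
    Finset.sum_range_sub (fun j => Λ.expect (T.Z j i))]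
  have : T.Z 0 i = fun _ => 0 := funext (T.Z_zero i)
  rw [this, expect_const, sub_zero]

/-- Fingerprinting brings in all users, secrecy removes those outside `S`, and for each user left
the correlations telescope to its final score, which is capped. -/
theorem sum_expect_le (hσ : 0 ≤ σ) :
    ∑ j, Λ.expect (fun ω => T.a j ω * (2 * Λ.pt (ω j).1 - 1)) ≤ S.card * (σ + 1) := by
  have h (j : Fin k) : Λ.expect (fun ω => T.a j ω * (2 * Λ.pt (ω j).1 - 1)) =
      ∑ i ∈ S, Λ.expect (fun ω => T.a j ω * Λ.dev (ω j) i) := by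
    rw [← expect_fingerprint j (T.a j) (T.a_update_node j)]
    simp_rw [Finset.mul_sum]
    rw [expect_sum]
    exact (Finset.sum_subset (Finset.subset_univ S)
      fun i _ hi => T.expect_a_mul_dev_of_notMem j hi).symm
  simp_rw [h]
  rw [Finset.sum_comm]
  simp_rw [T.sum_expect_a_mul_dev]
  rw [← nsmul_eq_mul]
  refine Finset.sum_le_card_nsmul _ _ _ fun i _ => ?_
  rw [← expect_const (Λ := Λ) (k := k) (σ + 1)]
  exact expect_mono fun ω => T.Z_le hσ i ω le_rfl

/-- For a user whose key the oracle lacks, each increment is uncorrelated with the current score, so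
the second moment grows by at most `1` per round. -/
theorem expect_Z_sq_le {i : Fin N} (hi : i ∉ S) {j : ℕ} (hj : j ≤ k) :
    Λ.expect (fun ω => T.Z j i ω ^ 2) ≤ j := by
  induction j with
  | zero => simp [T.Z_zero, expect_const]
  | succ j ih =>
    let j' : Fin k := ⟨j, hj⟩
    have h := expect_mul_dev_eq_zero true i j'
      (fun ω => if T.Z j' i ω ≤ σ then T.Z j' i ω * T.a j' ω else 0) fun ω => by
        simp only [T.Z_flip_of_notMem j' ω i hi, T.a_flip_of_notMem j' ω i hi]
    have hstep : Λ.expect (fun ω => T.Z (j + 1) i ω ^ 2) ≤ Λ.expect (fun ω => T.Z j i ω ^ 2 + 1 +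
        2 * ((if T.Z j' i ω ≤ σ then T.Z j' i ω * T.a j' ω else 0) * Λ.dev (ω j') i)) := by
      refine expect_mono fun ω => ?_
      have hd := sq_le_one_iff_abs_le_one _ |>.2 (Λ.abs_dev_le_one (ω j') i)
      have ha : T.a j' ω ^ 2 ≤ 1 := pow_le_one₀ (T.a_nonneg j' ω) (T.a_le_one j' ω)
      have had : (T.a j' ω * Λ.dev (ω j') i) ^ 2 ≤ 1 := by
        rw [mul_pow]
        exact mul_le_one₀ ha (sq_nonneg _) hd
      rw [T.Z_succ j']
      split_ifs
      · simp only [j'] at had ⊢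
        linarith
      · simp only [j']
        linarith
    rw [expect_add, expect_add, expect_const, expect_const_mul, h] at hstep
    have := ih (Nat.le_of_succ_le hj)
    push_cast
    linarith

/-- If the answers track the population means of the queries, in which accused users count as
zero, then the number of rounds is bounded. -/
theorem rounds_le (hσ : 0 < σ) (hN : 0 < N) {α β δ : ℝ} (hδ : 0 < δ) (g : (Fin k → Λ.Round) → ℝ)
    (hg : 1 - β ≤ Λ.expect g)
    (hacc : ∀ j ω, |T.a j ω - (∑ i, if T.Z j i ω ≤ σ ∧ (ω j).2.1 i = true then 1 else 0) / N| ≤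
      α + (1 - g ω)) :
    k * (1 / 6 - β - α - (δ + 1 / (δ * N)) / 2 - S.card / N - k / σ ^ 2) ≤ S.card * (σ + 1) := by
  refine le_trans ?_ (T.sum_expect_le hσ.le)
  have hNr : (0 : ℝ) < N := by exact_mod_cast hN
  rw [← nsmul_eq_mul]
  have hround (j : Fin k) : 1 / 6 - β - α - (δ + 1 / (δ * N)) / 2 - S.card / N - k / σ ^ 2 ≤
      Λ.expect (fun ω => T.a j ω * (2 * Λ.pt (ω j).1 - 1)) := by
    -- A pointwise bound whose terms all have known expectations: the ideal value for `a = p`, the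
    -- inaccuracy, the fluctuation of the codeword and the accused users.
    have hpt (ω : Fin k → Λ.Round) : (2 * Λ.pt (ω j).1 - 1) * Λ.pt (ω j).1 - (α + (1 - g ω)) -
        1 / 2 * (δ + 1 / (δ * N ^ 2) * (∑ i, Λ.dev (ω j) i) ^ 2) -
        1 / N * (S.card + ∑ i ∈ Finset.univ \ S, 1 / σ ^ 2 * T.Z j i ω ^ 2) ≤
        T.a j ω * (2 * Λ.pt (ω j).1 - 1) := by
      set p := Λ.pt (ω j).1
      have hp0 : 0 ≤ p := Λ.pt_nonneg _
      have hp1 : p ≤ 1 := Λ.pt_le_one _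
      set m := (∑ i, if T.Z j i ω ≤ σ ∧ (ω j).2.1 i = true then (1 : ℝ) else 0) / N
      set D := ∑ i, Λ.dev (ω j) i
      set B : ℝ := S.card + ∑ i ∈ Finset.univ \ S, 1 / σ ^ 2 * T.Z j i ω ^ 2
      have hdiff : |m - p| ≤ |D| / N + 1 / N * B := by
        have hmp : m - p = D / N - (∑ i, if ¬ T.Z j i ω ≤ σ ∧ (ω j).2.1 i = true then
            (1 : ℝ) else 0) / N := by
          have : p = (∑ _i : Fin N, p) / N := by
            simp [mul_div_cancel_left₀ _ hNr.ne']
          rw [this]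
          simp only [m, D]
          rw [← sub_div, ← sub_div, ← Finset.sum_sub_distrib, ← Finset.sum_sub_distrib]
          congr 1
          refine Finset.sum_congr rfl fun i _ => ?_
          simp only [dev, p]
          by_cases h1 : T.Z j i ω ≤ σ <;> by_cases h2 : (ω j).2.1 i = true <;> simp [h1, h2]
        have hacc0 : 0 ≤ ∑ i, (if ¬ T.Z j i ω ≤ σ ∧ (ω j).2.1 i = true then (1 : ℝ) else 0) :=
          Finset.sum_nonneg fun i _ => by split_ifs <;> norm_num
        -- Users in `S` are charged `1` each, accused or not; for the others the indicator of `Z >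
        -- σ` is at most `Z ^ 2 / σ ^ 2`, as in Chebyshev's inequality.
        have hB : ∑ i, (if ¬ T.Z j i ω ≤ σ ∧ (ω j).2.1 i = true then (1 : ℝ) else 0) ≤ B := by
          rw [← Finset.sum_sdiff (Finset.subset_univ S), add_comm]
          refine add_le_add ?_ (Finset.sum_le_sum fun i _ => ?_)
          · rw [← nsmul_one S.card]
            refine Finset.sum_le_card_nsmul _ _ _ fun i _ => ?_
            split_ifs <;> norm_num
          · split_ifs with h
            · have hz := not_le.1 h.1
              rw [one_div, inv_mul_eq_div, one_le_div (by positivity)]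
              exact pow_le_pow_left₀ hσ.le hz.le 2
            · positivity
        rw [hmp]
        refine (abs_sub _ _).trans (add_le_add ?_ ?_)
        · rw [abs_div, abs_of_pos hNr]
        · rw [abs_div, abs_of_pos hNr, abs_of_nonneg hacc0, one_div, inv_mul_eq_div]
          gcongr
      -- AM-GM trades `|D|` for its square, whose expectation is at most `N`.
      have hamgm : |D| / N ≤ 1 / 2 * (δ + 1 / (δ * N ^ 2) * D ^ 2) := by
        have h2 : 0 ≤ (δ - |D| / N) ^ 2 / δ := by positivity
        have h3 : (δ - |D| / N) ^ 2 / δ = δ - 2 * (|D| / N) + 1 / (δ * N ^ 2) * D ^ 2 := by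
          rw [← sq_abs D]
          field_simp
          ring
        linarith
      have h1 := hacc j ω
      have htot : |T.a j ω - p| ≤ α + (1 - g ω) + |m - p| :=
        (abs_sub_le _ m _).trans (add_le_add_left h1 _)
      have habs : |(T.a j ω - p) * (2 * p - 1)| ≤ |T.a j ω - p| := by
        rw [abs_mul]
        refine mul_le_of_le_one_right (abs_nonneg _) (abs_le.2 ⟨?_, ?_⟩) <;> linarith
      have := (abs_le.1 habs).1
      linarith
    refine le_trans ?_ (expect_mono hpt)
    rw [expect_sub, expect_sub, expect_sub, expect_add, expect_const, expect_sub, expect_const,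
      expect_const_mul, expect_add, expect_const, expect_const_mul, expect_const_mul, expect_add,
      expect_const, expect_sum, Λ.expect_comp_node j fun l => (2 * Λ.pt l - 1) * Λ.pt l, Λ.correlation]
    have hZ : ∑ i ∈ Finset.univ \ S, Λ.expect (fun ω => 1 / σ ^ 2 * T.Z j i ω ^ 2) ≤
        N * (k / σ ^ 2) := by
      have hcard : ((Finset.univ \ S).card : ℝ) ≤ N := by
        exact_mod_cast (Finset.card_le_univ _).trans (Fintype.card_fin N).le
      refine (Finset.sum_le_card_nsmul _ _ (k / σ ^ 2) fun i hi => ?_).trans ?_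
      · rw [expect_const_mul, one_div, inv_mul_eq_div]
        have hj : (j : ℝ) ≤ k := by exact_mod_cast j.2.le
        have := T.expect_Z_sq_le (i := i) (by simpa using hi) j.2.le
        gcongr
        exact this.trans hj
      · rw [nsmul_eq_mul]
        gcongr
    have hD : 1 / (δ * N ^ 2) * Λ.expect (fun ω => (∑ i, Λ.dev (ω j) i) ^ 2) ≤ 1 / (δ * N) := by
      refine (mul_le_mul_of_nonneg_left (Λ.expect_sq_sum_dev_le j) (by positivity)).trans_eq ?_
      field_simp
    have hB : 1 / N * (S.card + ∑ i ∈ Finset.univ \ S,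
        Λ.expect (fun ω => 1 / σ ^ 2 * T.Z j i ω ^ 2)) ≤ S.card / N + k / σ ^ 2 := by
      refine (mul_le_mul_of_nonneg_left (add_le_add_right hZ _) (by positivity)).trans_eq ?_
      field_simp
    linarith
  simpa using Finset.card_nsmul_le_sum Finset.univ _ _ fun j _ => hround j

end Attack

end FingerprintLaw

/-! ### The concrete adversary -/

namespace FingerprintLaw

variable {N k : ℕ} {Λ : FingerprintLaw N}

/-- The score of user `i` after the first `j` answers. It freezes once it exceeds `σ`. -/
noncomputable def score (σ : ℝ) (ω : Fin k → Λ.Round) (i : Fin N) :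
    (j : ℕ) → (Fin j → StatQuery (k + N) × unitInterval) → ℝ
  | 0, _ => 0
  | j + 1, t =>
    let z := score σ ω i j (Fin.init t)
    if h : j < k then
      if z ≤ σ then z + ((t (Fin.last j)).2 : ℝ) * Λ.dev (ω ⟨j, h⟩) i else z
    else z

/-- The encrypted query of round `j`: users that are not yet accused decrypt it with their key to
their codeword bit, and accused users evaluate it to zero. -/
noncomputable def attackQuery (σ : ℝ) (j : ℕ) (ω : Fin k → Λ.Round)
    (t : Fin j → StatQuery (k + N) × unitInterval) : StatQuery (k + N) := fun x =>
  open Classical in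
  if h : j < k then
    decide (∃ i : Fin N, x (Fin.natAdd k i) = true ∧ score σ ω i j t ≤ σ ∧
      (((ω ⟨j, h⟩).2.1 i ^^ (ω ⟨j, h⟩).2.2 i) ^^ x (Fin.castAdd N ⟨j, h⟩)) = true)
  else false

/-- The data point of user `i`: its key, followed by the unary encoding of its name. -/
def point (ω : Fin k → Λ.Round) (i : Fin N) : DataPoint (k + N) :=
  Fin.append (fun j => (ω j).2.2 i) fun i' => decide (i' = i)

theorem measurable_score (σ : ℝ) (ω : Fin k → Λ.Round) (i : Fin N) (j : ℕ) :
    Measurable (score σ ω i j) := by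
  induction j with
  | zero => exact measurable_const
  | succ j ih =>
    have hinit : Measurable fun t : Fin (j + 1) → StatQuery (k + N) × unitInterval =>
        score σ ω i j (Fin.init t) :=
      ih.comp (measurable_pi_iff.2 fun j' => measurable_pi_apply _)
    have hlast : Measurable fun t : Fin (j + 1) → StatQuery (k + N) × unitInterval =>
        ((t (Fin.last j)).2 : ℝ) :=
      measurable_subtype_coe.comp (measurable_snd.comp (measurable_pi_apply _))
    have heq : score σ ω i (j + 1) = fun t =>
        if h : j < k then
          if score σ ω i j (Fin.init t) ≤ σ then
            score σ ω i j (Fin.init t) + ((t (Fin.last j)).2 : ℝ) * Λ.dev (ω ⟨j, h⟩) i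
          else score σ ω i j (Fin.init t)
        else score σ ω i j (Fin.init t) := rfl
    rw [heq]
    by_cases h : j < k
    · simp only [h, dite_true]
      exact Measurable.ite (measurableSet_le hinit measurable_const)
        (hinit.add (hlast.mul_const _)) hinit
    · simpa only [h, dite_false] using hinit

theorem measurable_attackQuery (σ : ℝ) (j : ℕ) (ω : Fin k → Λ.Round) :
    Measurable (attackQuery σ j ω) := by
  refine measurable_pi_iff.2 fun x => ?_
  unfold attackQuery
  by_cases h : j < k
  · simp only [h, dite_true]
    refine measurable_to_bool ?_
    simp only [Set.preimage, Set.mem_singleton_iff, decide_eq_true_eq]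
    rw [Set.ofPred_exists]
    exact MeasurableSet.iUnion fun i => (MeasurableSet.const _).inter
      ((measurableSet_le (measurable_score σ ω i j) measurable_const).inter (MeasurableSet.const _))
  · simp only [h, dite_false]
    exact measurable_const

theorem score_congr (σ : ℝ) {ω ω' : Fin k → Λ.Round} (i : Fin N) {j : ℕ}
    (h : ∀ j' : Fin k, (j' : ℕ) < j → ω j' = ω' j')
    (t : Fin j → StatQuery (k + N) × unitInterval) : score σ ω i j t = score σ ω' i j t := by
  induction j with
  | zero => rfl
  | succ j ih =>
    have hih := ih (fun j' hj' => h j' (Nat.lt_succ_of_lt hj')) (Fin.init t)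
    simp only [score, hih]
    by_cases hj : j < k
    · simp only [hj, dite_true, h ⟨j, hj⟩ (Nat.lt_succ_self j)]
    · simp only [hj, dite_false]

/-- The current round enters a query only through the ciphertext bits of users not yet accused. -/
theorem attackQuery_congr (σ : ℝ) {ω ω' : Fin k → Λ.Round} {j : ℕ}
    (h : ∀ j' : Fin k, (j' : ℕ) < j → ω j' = ω' j')
    (t : Fin j → StatQuery (k + N) × unitInterval)
    (hbit : ∀ (hj : j < k) (i : Fin N), score σ ω i j t ≤ σ →
      ((ω ⟨j, hj⟩).2.1 i ^^ (ω ⟨j, hj⟩).2.2 i) = ((ω' ⟨j, hj⟩).2.1 i ^^ (ω' ⟨j, hj⟩).2.2 i)) :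
    attackQuery σ j ω t = attackQuery σ j ω' t := by
  funext x
  unfold attackQuery
  split_ifs with hj
  · congr 1
    refine propext (exists_congr fun i => and_congr_right fun _ => ?_)
    rw [← score_congr σ i h t]
    exact and_congr_right fun hi => by rw [hbit hj i hi]
  · rfl

/-- The unary name singles out user `i`, and its key bit cancels the pad. -/
theorem attackQuery_point (σ : ℝ) (j : Fin k) (ω : Fin k → Λ.Round)
    (t : Fin j → StatQuery (k + N) × unitInterval) (i : Fin N) :
    attackQuery σ j ω t (point ω i) = true ↔ score σ ω i j t ≤ σ ∧ (ω j).2.1 i = true := by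
  simp [attackQuery, point]

theorem update_eq_of_lt (ω : Fin k → Λ.Round) (j : Fin k) (ρ : Λ.Round) (j' : Fin k)
    (h : (j' : ℕ) < j) : Function.update ω j ρ j' = ω j' :=
  Function.update_of_ne (fun e => by simp [e] at h) _ _

theorem point_update_of_eq (ω : Fin k → Λ.Round) (i : Fin N) (j : Fin k) (ρ : Λ.Round)
    (h : ρ.2.2 i = (ω j).2.2 i) : point (Function.update ω j ρ) i = point ω i := by
  unfold point
  congr 1
  funext j'
  by_cases hj : j' = j
  · subst hj
    simpa using h
  · rw [Function.update_of_ne hj]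

variable [NeZero N]

noncomputable def tapeLaw (Λ : FingerprintLaw N) (k : ℕ) : PMF (Fin k → Λ.Round) :=
  PMF.ofFintype (fun ω => ENNReal.ofReal (Λ.tapeWeight ω)) (by
    rw [← ENNReal.ofReal_sum_of_nonneg fun ω _ => Λ.tapeWeight_nonneg ω, Λ.sum_tapeWeight,
      ENNReal.ofReal_one])

/-- The fingerprinting adversary. -/
noncomputable def adversary (Λ : FingerprintLaw N) (k : ℕ) (σ : ℝ) : Adversary (k + N) where
  Coins := Fin k → Λ.Round
  measurableSpace := ⊤
  law := @PMF.toMeasure _ ⊤ (Λ.tapeLaw k)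
  isProbabilityMeasure := by
    let _ : MeasurableSpace (Fin k → Λ.Round) := ⊤
    exact PMF.toMeasure.isProbabilityMeasure _
  dist ω := (PMF.uniformOfFintype (Fin N)).map (point ω)
  measurable_dist _ := measurable_from_top
  query j ω t := attackQuery σ j ω t
  measurable_query j := by
    let _ : MeasurableSpace (Fin k → Λ.Round) := ⊤
    have : MeasurableSingletonClass (Fin k → Λ.Round) := ⟨fun _ => trivial⟩
    exact measurable_from_prod_countable_right fun ω => measurable_attackQuery σ j ω

theorem value_dist (σ : ℝ) (q : StatQuery (k + N)) (ω : Fin k → Λ.Round) :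
    q.value ((Λ.adversary k σ).dist ω) = (∑ i, if q (point ω i) = true then 1 else 0) / N := by
  have hN : (N : ENNReal)⁻¹ ≠ ⊤ := by simp [NeZero.ne N]
  have h (x : DataPoint (k + N)) : (((Λ.adversary k σ).dist ω) x).toReal =
      ∑ i, if x = point ω i then (N : ℝ)⁻¹ else 0 := by
    simp only [adversary, PMF.map_apply, tsum_fintype, PMF.uniformOfFintype_apply,
      Fintype.card_fin]
    rw [ENNReal.toReal_sum fun i _ => by split_ifs <;> simp [NeZero.ne N]]
    refine Finset.sum_congr rfl fun i _ => ?_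
    split_ifs <;> simp
  simp only [StatQuery.value, h, Finset.sum_mul]
  rw [Finset.sum_comm, Finset.sum_div]
  refine Finset.sum_congr rfl fun i _ => ?_
  rw [Finset.sum_eq_single (point ω i)]
  · rw [if_pos rfl]
    split_ifs <;> simp
  · intro x _ hx
    simp [hx]
  · simp

/-! ### Its interaction with an oracle -/

section Run

variable {n : ℕ} (O : StatOracle n (k + N)) (ωO : O.Coins) (x : Fin n → DataPoint (k + N)) (σ : ℝ)
  (ω : Fin k → Λ.Round)

/-- The interaction of an oracle with the fingerprinting adversary. -/
noncomputable abbrev run (j : ℕ) : Fin j → StatQuery (k + N) × unitInterval :=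
  transcript O (Λ.adversary k σ) ω x ωO j

/-- The answer to query number `j`. -/
noncomputable def runAnswer (j : ℕ) : ℝ :=
  O.answer j ωO x (fun i => (run O ωO x σ ω j i).1) (attackQuery σ j ω (run O ωO x σ ω j))

theorem run_succ (j : ℕ) : run O ωO x σ ω (j + 1) =
    Fin.snoc (α := fun _ => StatQuery (k + N) × unitInterval) (run O ωO x σ ω j)
      (attackQuery σ j ω (run O ωO x σ ω j),
        O.answer j ωO x (fun i => (run O ωO x σ ω j i).1)
          (attackQuery σ j ω (run O ωO x σ ω j))) := rfl

theorem run_apply {j m : ℕ} (h : j < m) : run O ωO x σ ω m ⟨j, h⟩ =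
    (attackQuery σ j ω (run O ωO x σ ω j),
      O.answer j ωO x (fun i => (run O ωO x σ ω j i).1)
        (attackQuery σ j ω (run O ωO x σ ω j))) := by
  induction m with
  | zero => exact absurd h (Nat.not_lt_zero j)
  | succ m ih =>
    rw [run_succ]
    rcases Nat.lt_succ_iff_lt_or_eq.1 h with hj | rfl
    · rw [← ih hj]
      exact Fin.snoc_castSucc (α := fun _ => StatQuery (k + N) × unitInterval) _ _ ⟨j, hj⟩
    · exact Fin.snoc_last (α := fun _ => StatQuery (k + N) × unitInterval) _ _

theorem score_run_succ (i : Fin N) (j : Fin k) :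
    score σ ω i (j + 1) (run O ωO x σ ω (j + 1)) =
      if score σ ω i j (run O ωO x σ ω j) ≤ σ then
        score σ ω i j (run O ωO x σ ω j) + runAnswer O ωO x σ ω j * Λ.dev (ω j) i
      else score σ ω i j (run O ωO x σ ω j) := by
  rw [run_succ]
  simp only [score, Fin.init_snoc, Fin.snoc_last, j.2, dite_true, runAnswer]

variable {σ ω} in
theorem run_congr {ω' : Fin k → Λ.Round} {j : ℕ}
    (h : ∀ j' : Fin k, (j' : ℕ) < j → ω j' = ω' j') : run O ωO x σ ω j = run O ωO x σ ω' j := by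
  induction j with
  | zero => rfl
  | succ j ih =>
    have h' (j' : Fin k) (hj' : (j' : ℕ) < j) : ω j' = ω' j' := h j' (Nat.lt_succ_of_lt hj')
    have hq : attackQuery σ j ω (run O ωO x σ ω' j) = attackQuery σ j ω' (run O ωO x σ ω' j) :=
      attackQuery_congr σ h' _ fun hj i _ => by rw [h ⟨j, hj⟩ (Nat.lt_succ_self j)]
    rw [run_succ, run_succ, ih h', hq]

end Run

theorem runAnswer_update {n : ℕ} (O : StatOracle n (k + N)) (ωO : O.Coins)
    (x : Fin n → DataPoint (k + N)) (σ : ℝ) (ω : Fin k → Λ.Round) (j : Fin k) (ρ : Λ.Round)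
    (hbit : ∀ i, score σ ω i j (run O ωO x σ ω j) ≤ σ →
      (ρ.2.1 i ^^ ρ.2.2 i) = ((ω j).2.1 i ^^ (ω j).2.2 i)) :
    runAnswer O ωO x σ (Function.update ω j ρ) j = runAnswer O ωO x σ ω j := by
  have h := update_eq_of_lt ω j ρ
  have hrun : run O ωO x σ (Function.update ω j ρ) j = run O ωO x σ ω j := run_congr O ωO x h
  have hq : attackQuery σ j (Function.update ω j ρ) (run O ωO x σ ω j) =
      attackQuery σ j ω (run O ωO x σ ω j) := by
    refine attackQuery_congr σ h _ fun hj i hi => ?_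
    rw [score_congr σ i h] at hi
    simpa using hbit i hi
  simp only [runAnswer, hrun, hq]

theorem score_run_update {n : ℕ} (O : StatOracle n (k + N)) (ωO : O.Coins)
    (x : Fin n → DataPoint (k + N)) (σ : ℝ) (ω : Fin k → Λ.Round) (i : Fin N) (j : Fin k)
    (ρ : Λ.Round) :
    score σ (Function.update ω j ρ) i j (run O ωO x σ (Function.update ω j ρ) j) =
      score σ ω i j (run O ωO x σ ω j) := by
  have h := update_eq_of_lt ω j ρ
  rw [run_congr O ωO x h, score_congr σ i h]

/-- The attack on the oracle with tape `ωO` that holds the data of the users `I`. -/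
noncomputable def oracleAttack (Λ : FingerprintLaw N) (k : ℕ) {n : ℕ} (O : StatOracle n (k + N))
    (ωO : O.Coins) (I : Fin n → Fin N) (σ : ℝ) : Attack Λ k σ (Finset.univ.image I) where
  a j ω := runAnswer O ωO (fun s => point ω (I s)) σ ω j
  Z j i ω := score σ ω i j (run O ωO (fun s => point ω (I s)) σ ω j)
  Z_zero _ _ := rfl
  Z_succ j i ω := score_run_succ O ωO _ σ ω i j
  a_nonneg _ _ := (O.answer _ _ _ _ _).2.1
  a_le_one _ _ := (O.answer _ _ _ _ _).2.2
  a_update_node j ω l := by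
    simp only [point_update_of_eq ω _ j (l, (ω j).2) rfl]
    exact runAnswer_update O ωO _ σ ω j _ fun _ _ => rfl
  -- Flipping bit and key together preserves the ciphertext, and the changed key is not among the
  -- samples.
  a_flip_of_notMem j ω i hi := by
    have hI (s : Fin n) : I s ≠ i := fun e => hi (by simp [← e])
    have hp (s : Fin n) := point_update_of_eq ω (I s) j (flip true i (ω j)) (by
      simp [flip, hI s])
    simp only [hp]
    refine runAnswer_update O ωO _ σ ω j _ fun i' _ => ?_
    by_cases h : i' = i
    · subst h
      simp [flip]
    · simp [flip, h]
  a_flip_of_lt j ω i hi := by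
    simp only [point_update_of_eq ω _ j (flip false i (ω j)) rfl]
    refine runAnswer_update O ωO _ σ ω j _ fun i' hi' => ?_
    have h : i' ≠ i := fun e => absurd hi' (not_le.2 (e ▸ hi))
    simp [flip, h]
  Z_flip_of_notMem j ω i hi := by
    have hI (s : Fin n) : I s ≠ i := fun e => hi (by simp [← e])
    have hp (s : Fin n) := point_update_of_eq ω (I s) j (flip true i (ω j)) (by
      simp [flip, hI s])
    simp only [hp]
    exact score_run_update O ωO _ σ ω i j _
  Z_flip j ω i := by
    simp only [point_update_of_eq ω _ j (flip false i (ω j)) rfl]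
    exact score_run_update O ωO _ σ ω i j _

/-- The event that all answers are accurate. -/
def accurateSet {n : ℕ} (O : StatOracle n (k + N)) (σ α : ℝ) (ω : Fin k → Λ.Round) :
    Set ((Fin n → DataPoint (k + N)) × O.Coins) :=
  {p | ∀ j : Fin k, |((run O p.2 p.1 σ ω k j).2 : ℝ) -
    (run O p.2 p.1 σ ω k j).1.value ((Λ.adversary k σ).dist ω)| ≤ α}

open Classical in
/-- An accurate oracle, with its tape and the identities of the sampled users fixed, can only
answer a bounded number of queries. -/
theorem rounds_le_of_accurate {n : ℕ} (O : StatOracle n (k + N)) (ωO : O.Coins)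
    (I : Fin n → Fin N) {σ α β δ : ℝ} (hσ : 0 < σ) (hα : 0 ≤ α) (hδ : 0 < δ)
    (h : 1 - β ≤ Λ.expect fun ω =>
      if (fun s => point ω (I s), ωO) ∈ accurateSet O σ α ω then 1 else 0) :
    k * (1 / 6 - β - α - (δ + 1 / (δ * N)) / 2 - n / N - k / σ ^ 2) ≤ n * (σ + 1) := by
  have hN : (0 : ℝ) < N := by exact_mod_cast NeZero.pos N
  have hcard : ((Finset.univ.image I).card : ℝ) ≤ n := by
    exact_mod_cast Finset.card_image_le.trans (by simp)
  refine le_trans ?_ (((oracleAttack Λ k O ωO I σ).rounds_le (α := α) hσ (NeZero.pos N) hδ _ h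
    fun j ω => ?_).trans ?_)
  · gcongr
  · have hvalue := value_dist σ
      (attackQuery σ j ω (run O ωO (fun s => point ω (I s)) σ ω j)) ω
    simp only [attackQuery_point] at hvalue
    have ha0 := (oracleAttack Λ k O ωO I σ).a_nonneg j ω
    have ha1 := (oracleAttack Λ k O ωO I σ).a_le_one j ω
    split_ifs with hgood
    · have hj := hgood j
      rw [run_apply O ωO _ σ ω j.2, hvalue] at hj
      rw [sub_self, add_zero]
      exact hj
    -- Off the accurate event the allowance is `α + 1`, which is trivial for two numbers in `[0,1]`.
    · rw [abs_le]
      have hle : (∑ i, if (oracleAttack Λ k O ωO I σ).Z j i ω ≤ σ ∧ (ω j).2.1 i = true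
          then (1 : ℝ) else 0) / N ≤ 1 := by
        rw [div_le_one hN]
        refine (Finset.sum_le_card_nsmul _ _ 1 fun i _ => ?_).trans (by simp)
        split_ifs <;> norm_num
      have hge : 0 ≤ (∑ i, if (oracleAttack Λ k O ωO I σ).Z j i ω ≤ σ ∧ (ω j).2.1 i = true
          then (1 : ℝ) else 0) / N :=
        div_nonneg (Finset.sum_nonneg fun i _ => by split_ifs <;> norm_num) hN.le
      constructor <;> linarith
  · gcongr

end FingerprintLaw

/-! ### Measurability and derandomization -/

namespace FingerprintLaw

variable {N k : ℕ} [NeZero N] {Λ : FingerprintLaw N}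

theorem measurable_run {n : ℕ} (O : StatOracle n (k + N)) (x : Fin n → DataPoint (k + N)) (σ : ℝ)
    (ω : Fin k → Λ.Round) (j : ℕ) : Measurable fun ωO => run O ωO x σ ω j := by
  induction j with
  | zero => exact measurable_const
  | succ j ih =>
    have hq := (measurable_attackQuery σ j ω).comp ih
    have hh : Measurable fun ωO => fun i => (run O ωO x σ ω j i).1 :=
      measurable_pi_iff.2 fun i => measurable_fst.comp ((measurable_pi_apply i).comp ih)
    have hans : Measurable fun p : O.Coins × (Fin j → StatQuery (k + N)) × StatQuery (k + N) =>
        O.answer j p.1 x p.2.1 p.2.2 :=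
      measurable_from_prod_countable_left fun q => O.measurable_answer j x q.1 q.2
    simp_rw [run_succ]
    refine measurable_pi_iff.2 fun i => ?_
    induction i using Fin.lastCases with
    | last =>
      simp only [Fin.snoc_last]
      exact hq.prodMk (hans.comp (measurable_id.prodMk (hh.prodMk hq)))
    | cast i =>
      simp only [Fin.snoc_castSucc]
      exact (measurable_pi_apply i).comp ih

theorem measurableSet_accurateSet {n : ℕ} (O : StatOracle n (k + N)) (σ α : ℝ)
    (ω : Fin k → Λ.Round) : MeasurableSet (accurateSet O σ α ω) := by
  have hrun : Measurable fun p : (Fin n → DataPoint (k + N)) × O.Coins =>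
      run O p.2 p.1 σ ω k :=
    measurable_from_prod_countable_right fun x => measurable_run O x σ ω k
  have hvalue : Measurable fun q : StatQuery (k + N) => q.value ((Λ.adversary k σ).dist ω) :=
    measurable_of_countable _
  unfold accurateSet
  rw [Set.ofPred_forall]
  refine MeasurableSet.iInter fun j => ?_
  have hj := (measurable_pi_apply j).comp hrun
  exact measurableSet_le ((measurable_subtype_coe.comp (measurable_snd.comp hj)).sub
    (hvalue.comp (measurable_fst.comp hj))).abs measurable_const

/-- Sampling from `D` amounts to drawing identities of users and reading off their points. The law
of the identities does not depend on the adversary's tape, so they can be drawn first. -/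
theorem accuracyProb_adversary {n : ℕ} (O : StatOracle n (k + N)) (σ α : ℝ) :
    accuracyProb O (Λ.adversary k σ) k α =
      ∫⁻ I, ∑ ω, ENNReal.ofReal (Λ.tapeWeight ω) *
          O.law {ωO | (fun s => point ω (I s), ωO) ∈ accurateSet O σ α ω}
        ∂Measure.pi fun _ : Fin n => (PMF.uniformOfFintype (Fin N)).toMeasure := by
  have hinner (ω : Fin k → Λ.Round) :
      ((Measure.pi fun _ : Fin n => ((Λ.adversary k σ).dist ω).toMeasure).prod O.law)
        (accurateSet O σ α ω) =
      ∫⁻ I, O.law {ωO | (fun s => point ω (I s), ωO) ∈ accurateSet O σ α ω}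
        ∂Measure.pi fun _ : Fin n => (PMF.uniformOfFintype (Fin N)).toMeasure := by
    have hmap : ((Λ.adversary k σ).dist ω).toMeasure =
        (PMF.uniformOfFintype (Fin N)).toMeasure.map (point ω) :=
      (PMF.toMeasure_map _ _ (measurable_of_countable _)).symm
    rw [hmap, ← Measure.pi_map_pi fun _ => (measurable_of_countable (point ω)).aemeasurable,
      Measure.prod_apply (measurableSet_accurateSet O σ α ω),
      lintegral_map (measurable_of_countable _) (measurable_of_countable _)]
    rfl
  rw [lintegral_finsetSum _ fun ω _ => measurable_of_countable _]
  simp_rw [lintegral_const_mul _ (measurable_of_countable _), ← hinner]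
  let _ : MeasurableSpace (Fin k → Λ.Round) := ⊤
  have : MeasurableSingletonClass (Fin k → Λ.Round) := ⟨fun _ => trivial⟩
  refine (lintegral_fintype (μ := (Λ.tapeLaw k).toMeasure) _).trans
    (Finset.sum_congr rfl fun ω _ => ?_)
  rw [PMF.toMeasure_apply_singleton _ _ (measurableSet_singleton _), mul_comm]
  rfl

open Classical in
/-- Against the fingerprinting adversary, an oracle is at least as accurate for some fixed tape and
some fixed identities of the sampled users as it is on average. -/
theorem exists_accurate {n : ℕ} (O : StatOracle n (k + N)) (σ : ℝ) {α β : ℝ}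
    (h : O.IsAccurate α β k) : ∃ (ωO : O.Coins) (I : Fin n → Fin N),
      1 - β ≤ Λ.expect fun ω =>
        if (fun s => point ω (I s), ωO) ∈ accurateSet O σ α ω then 1 else 0 := by
  have h := h (Λ.adversary k σ)
  rw [accuracyProb_adversary] at h
  have hsum_ne (f : (Fin k → Λ.Round) → ENNReal) (hf : ∀ ω, f ω ≤ 1) :
      ∑ ω, ENNReal.ofReal (Λ.tapeWeight ω) * f ω ≤ 1 := by
    refine (Finset.sum_le_sum fun ω _ => mul_le_of_le_one_right' (hf ω)).trans ?_
    rw [← ENNReal.ofReal_sum_of_nonneg fun ω _ => Λ.tapeWeight_nonneg ω, Λ.sum_tapeWeight,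
      ENNReal.ofReal_one]
  obtain ⟨I, hI⟩ := exists_lintegral_le (μ := Measure.pi fun _ : Fin n =>
    (PMF.uniformOfFintype (Fin N)).toMeasure) (f := fun I => ∑ ω,
      ENNReal.ofReal (Λ.tapeWeight ω) *
        O.law {ωO | (fun s => point ω (I s), ωO) ∈ accurateSet O σ α ω})
    (ne_top_of_le_ne_top ENNReal.one_ne_top
      ((lintegral_mono fun I => hsum_ne _ fun ω => prob_le_one).trans (by simp)))
  have hmeas (ω : Fin k → Λ.Round) :
      MeasurableSet {ωO | (fun s => point ω (I s), ωO) ∈ accurateSet O σ α ω} :=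
    measurable_prodMk_left (measurableSet_accurateSet O σ α ω)
  have hsum : ∑ ω, ENNReal.ofReal (Λ.tapeWeight ω) *
        O.law {ωO | (fun s => point ω (I s), ωO) ∈ accurateSet O σ α ω} =
      ∫⁻ ωO, ∑ ω, ENNReal.ofReal (Λ.tapeWeight ω) *
        {ωO | (fun s => point ω (I s), ωO) ∈ accurateSet O σ α ω}.indicator 1 ωO ∂O.law := by
    rw [lintegral_finsetSum _ fun ω _ => (measurable_one.indicator (hmeas ω)).const_mul _]
    refine Finset.sum_congr rfl fun ω _ => ?_
    rw [lintegral_const_mul _ (measurable_one.indicator (hmeas ω)),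
      lintegral_indicator_one (hmeas ω)]
  have hind (ωO : O.Coins) : ∑ ω, ENNReal.ofReal (Λ.tapeWeight ω) *
      {ωO | (fun s => point ω (I s), ωO) ∈ accurateSet O σ α ω}.indicator 1 ωO ≤ 1 :=
    hsum_ne _ fun ω => Set.indicator_le_self' (fun _ _ => zero_le_one) _
  obtain ⟨ωO, hωO⟩ := exists_lintegral_le (μ := O.law) (ne_top_of_le_ne_top ENNReal.one_ne_top
    ((lintegral_mono hind).trans (by simp)))
  refine ⟨ωO, I, h.trans ?_⟩
  refine (ENNReal.toReal_mono (ne_top_of_le_ne_top ENNReal.one_ne_top (hind ωO))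
    (hI.trans (hsum.trans_le hωO))).trans_eq ?_
  rw [ENNReal.toReal_sum fun ω _ => ENNReal.mul_ne_top ENNReal.ofReal_ne_top (by
    rw [Set.indicator_apply]; split_ifs <;> simp)]
  refine Finset.sum_congr rfl fun ω _ => ?_
  rw [ENNReal.toReal_mul, ENNReal.toReal_ofReal (Λ.tapeWeight_nonneg ω), Set.indicator_apply]
  simp only [Set.mem_ofPred_eq]
  split_ifs <;> simp

end FingerprintLaw

/-! ### Choice of parameters -/

/-- The trade-off between accuracy and the number of adaptive queries. -/
theorem StatOracle.IsAccurate.rounds_le {n N k : ℕ} (hN : 0 < N) {O : StatOracle n (k + N)}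
    {α β : ℝ} (hα : 0 ≤ α) (h : O.IsAccurate α β k) {σ δ : ℝ}
    (hσ : 0 < σ) (hδ : 0 < δ) :
    k * (1 / 6 - β - α - (δ + 1 / (δ * N)) / 2 - n / N - k / σ ^ 2) ≤ n * (σ + 1) := by
  have : NeZero N := ⟨hN.ne'⟩
  obtain ⟨Λ⟩ := FingerprintLaw.nonempty N
  obtain ⟨ωO, I, hI⟩ := FingerprintLaw.exists_accurate (Λ := Λ) O σ h
  exact FingerprintLaw.rounds_le_of_accurate O ωO I hσ hα hδ hI

/-- A function between `n ^ c` and a multiple of it is `n ^ (c + o(1))`. -/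
theorem isPowPlusLittleO_of_le_of_le {f : ℕ → ℕ} {c : ℕ} {C : ℝ}
    (hlow : ∀ n, n ^ c ≤ f n) (hup : ∀ n, (f n : ℝ) ≤ C * n ^ c) : IsPowPlusLittleO f c := by
  have hC : 1 ≤ C := by
    have h1 : (1 : ℝ) ≤ f 1 := by exact_mod_cast (one_pow c).symm.le.trans (hlow 1)
    have h2 := hup 1
    simp only [Nat.cast_one, one_pow, mul_one] at h2
    linarith
  -- The exact excess exponent; it lies between `0` and `log C / log n`.
  refine ⟨fun n => Real.log (f n / n ^ c) / Real.log n, ?_, ?_⟩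
  · have hlog : Tendsto (fun n : ℕ => Real.log n) atTop atTop :=
      Real.tendsto_log_atTop.comp tendsto_natCast_atTop_atTop
    refine squeeze_zero' ?_ ?_ (hlog.const_div_atTop (Real.log C))
    · filter_upwards [eventually_ge_atTop 1] with n hn
      have hn' : (0 : ℝ) < n ^ c := by positivity
      refine div_nonneg (Real.log_nonneg ?_) (Real.log_natCast_nonneg n)
      rw [le_div_iff₀ hn', one_mul]
      exact_mod_cast hlow n
    · filter_upwards [eventually_ge_atTop 1] with n hn
      have hn' : (0 : ℝ) < n ^ c := by positivity
      have hf : (0 : ℝ) < f n := by exact_mod_cast (by positivity : 0 < n ^ c).trans_le (hlow n)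
      refine div_le_div_of_nonneg_right (Real.log_le_log (div_pos hf hn') ?_)
        (Real.log_natCast_nonneg n)
      rw [div_le_iff₀ hn']
      exact hup n
  · filter_upwards [eventually_ge_atTop 2] with n hn
    have hn0 : (0 : ℝ) < n := by positivity
    have hn1 : Real.log n ≠ 0 := (Real.log_pos (by exact_mod_cast hn)).ne'
    have hf : (0 : ℝ) < f n := by exact_mod_cast (by positivity : 0 < n ^ c).trans_le (hlow n)
    rw [Real.rpow_add hn0, Real.rpow_natCast, Real.rpow_def_of_pos hn0, mul_div_cancel₀ _ hn1,
      Real.exp_log (by positivity)]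
    field_simp

theorem theorem2 :
    ∃ k d : ℕ → ℕ, IsPowPlusLittleO k 3 ∧ IsPowPlusLittleO d 3 ∧
      ¬ ∃ (O : (n : ℕ) → StatOracle n (d n)) (β : ℕ → ℝ),
        Tendsto β atTop (𝓝 0) ∧ ∀ n : ℕ, (O n).IsAccurate (1 / 2000) (β n) (k n) := by
  refine ⟨fun n => n ^ 3, fun n => n ^ 3 + n ^ 2, ?_, ?_, ?_⟩
  · exact_mod_cast isPowPlusLittleO_of_le_of_le (c := 3) (C := 1) (fun n => le_rfl)
      fun n => by simp
  · have h := isPowPlusLittleO_of_le_of_le (f := fun n => n ^ 3 + n ^ 2) (c := 3) (C := 2)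
      (fun n => Nat.le_add_right _ _) fun n => by
        have : n ^ 2 ≤ n ^ 3 := by
          rcases n.eq_zero_or_pos with rfl | hn
          · simp
          · exact Nat.pow_le_pow_right hn (by norm_num)
        have : (n : ℝ) ^ 2 ≤ n ^ 3 := by exact_mod_cast this
        push_cast
        linarith
    exact_mod_cast h
  · rintro ⟨O, β, hβ, hacc⟩
    obtain ⟨n, hβn, hn⟩ := ((hβ.eventually_lt_const (show (0 : ℝ) < 1 / 100 by norm_num)).and
      (eventually_ge_atTop 1000000)).exists
    have hnr : (1000000 : ℝ) ≤ n := by exact_mod_cast hn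
    have hn0 : (0 : ℝ) < n := by linarith
    -- Here `N = n^2`, and `δ = 1 / √N` minimizes `δ + 1 / (δ * N)`. This `σ` makes `k / σ ^ 2` of
    -- order `1 / n`, while `n * σ = k / 100` stays below the `k / 10` forced by accuracy.
    have h := StatOracle.IsAccurate.rounds_le (by positivity) (by norm_num) (hacc n)
      (σ := (n : ℝ) ^ 2 / 100) (δ := 1 / n)
      (by positivity) (by positivity)
    push_cast at h
    have hδ : (1 / (n : ℝ) + 1 / (1 / n * n ^ 2)) / 2 = 1 / n := by field_simp; norm_num
    have hS : (n : ℝ) / n ^ 2 = 1 / n := by field_simp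
    have hk : (n : ℝ) ^ 3 / (n ^ 2 / 100) ^ 2 = 10000 * (1 / n) := by field_simp; norm_num
    have hinv : 1 / (n : ℝ) ≤ 1 / 1000000 := one_div_le_one_div_of_le (by norm_num) hnr
    rw [hδ, hS, hk] at h
    have hlow : (1 : ℝ) / 10 ≤
        1 / 6 - β n - 1 / 2000 - 1 / n - 1 / n - 10000 * (1 / n) := by linarith
    have h2 := (mul_le_mul_of_nonneg_left hlow (by positivity : (0 : ℝ) ≤ n ^ 3)).trans h
    have h3 : (n : ℝ) * (n ^ 2 / 100 + 1) = n ^ 3 / 100 + n := by ring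
    have h4 : (1000000 : ℝ) * n ≤ n ^ 3 := by nlinarith
    linarith
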